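/- Let $G$ be a virtually abelian group (i.e. $G$ has an abelian subgroup of finite index), let $S\subseteq G$ be a finite set that generates $G$ as a monoid, let $\omega\colon S\to\{1,2,3,\dots\}$ be any weight function, and let $H\le G$ be any subgroup. Define the weight of a word $s_1s_2\cdots s_k$ over $S$ ($k\ge 0$) to be $\sum_{i=1}^k\omega(s_i)$, the weight $\omega(g)$ of $g\in G$ to be the minimal weight of a word over $S$ representing $g$, and the weight of a right coset $Hg\in H\backslash G$ to be $\omega(Hg)=\min\{\omega(g')\mid g'\in Hg\}$. Then for every $n\ge 0$ the number $\sigma(n)=\#\{c\in H\backslash G\mid \omega(c)=n\}$ is finite, and the weighted growth series of $H\backslash G$, \[ \sum_{n=0}^{\infty}\sigma(n)z^n , \] is rational: there are polynomials $p,q$ with integer coefficients, $q\neq 0$, such that it equals $p(z)/q(z)$. -/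

import Mathlib

open scoped Polynomial PowerSeries

namespace CosetGrowth

/-- A group is virtually abelian if it has an abelian subgroup of finite index. -/
def IsVirtuallyAbelian (G : Type*) [Group G] : Prop :=
  ∃ A : Subgroup G, IsMulCommutative A ∧ A.FiniteIndex

/-- The group element represented by a word over `S`. -/
def wordValue {G : Type*} [Group G] {S : Set G} (w : List S) : G :=
  (w.map (fun s => (s : G))).prod

/-- The weight of a word: the sum of the weights of its letters. -/
def wordWeight {G : Type*} {S : Set G} (ω : S → ℕ+) (w : List S) : ℕ :=
  (w.map (fun s => (ω s : ℕ))).sum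

/-- The weight of a group element: the minimal weight of a word over `S` that represents it.
(The set is nonempty when `S` generates `G` as a monoid.) -/
noncomputable def elementWeight {G : Type*} [Group G] {S : Set G} (ω : S → ℕ+) (g : G) : ℕ :=
  sInf {n | ∃ w : List S, wordValue w = g ∧ wordWeight ω w = n}

/-- The set `H \ G` of right cosets `Hg`. -/
abbrev RightCosets {G : Type*} [Group G] (H : Subgroup G) : Type _ :=
  Quotient (QuotientGroup.rightRel H)

/-- The weight of a right coset: the minimal weight of its elements. -/
noncomputable def cosetWeight {G : Type*} [Group G] {S : Set G} (ω : S → ℕ+)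
    (H : Subgroup G) (c : RightCosets H) : ℕ :=
  sInf {n | ∃ g : G, (Quotient.mk (QuotientGroup.rightRel H) g) = c ∧ elementWeight ω g = n}

/-- The right cosets of `H` of weight exactly `n`. -/
def cosetSphere {G : Type*} [Group G] {S : Set G} (ω : S → ℕ+)
    (H : Subgroup G) (n : ℕ) : Set (RightCosets H) :=
  {c | cosetWeight ω H c = n}

/-- The weighted growth series of `H \ G`: the coefficient of `z ^ n` is the number of right
cosets of weight `n`. -/
noncomputable def cosetGrowthSeries {G : Type*} [Group G] {S : Set G} (ω : S → ℕ+)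
    (H : Subgroup G) : ℤ⟦X⟧ :=
  PowerSeries.mk fun n => ((cosetSphere ω H n).ncard : ℤ)

/-- A power series over `ℤ` is rational if it equals `p / q` for integer polynomials `p` and
`q ≠ 0`; as `ℤ⟦X⟧` is a domain, this is the identity `q * f = p`. -/
def IsRationalSeries (f : ℤ⟦X⟧) : Prop :=
  ∃ p q : ℤ[X], q ≠ 0 ∧ (q : ℤ⟦X⟧) * f = (p : ℤ⟦X⟧)

end CosetGrowth

/-!
Let `A` be an abelian subgroup of finite index. Inversion turns right cosets into left cosets, and
the weight of a point `x` of `G ⧸ H` is the least weight of a word that moves `x` to the base point.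

There are finitely many `A`-orbits in `G ⧸ H`, and each is a copy of an abelian quotient `B` of `A`.
Words trace paths in the finite Schreier graph of `A`, with labels in the commutative monoid
`A × ℕ`, so Kleene's algorithm shows that the pairs `(b, n)` such that a word of weight `n` moves
`b` to the base point form a semilinear subset of `B × ℕ`. Its upward closure in the second
coordinate is the epigraph of the weight function on the orbit. It is semilinear as well, and the
graph is the epigraph minus its shift by one.

It remains to see that the generating function of a semilinear set with finitely many elements of
each weight is rational. Such a set is a finite union of sets `C + P` with `C` finite and `P` a
finitely generated submonoid whose nonzero elements have positive weight. By Dickson's lemma such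
sets are closed under intersection, so inclusion-exclusion reduces the claim to one set `C + P`.
Adding the translates `c + P` one at a time, the new elements are parametrised by their
lexicographically least representatives, which form a lower set in `ℕ ^ k`.
-/

namespace CosetGrowth

open Pointwise

/-! ### Rational power series -/

namespace IsRationalSeries

variable {f g : ℤ⟦X⟧}

theorem of_polynomial (p : ℤ[X]) : IsRationalSeries (p : ℤ⟦X⟧) :=
  ⟨p, 1, one_ne_zero, by simp⟩

theorem add (hf : IsRationalSeries f) (hg : IsRationalSeries g) : IsRationalSeries (f + g) := by
  obtain ⟨p, q, hq, h⟩ := hf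
  obtain ⟨p', q', hq', h'⟩ := hg
  refine ⟨p * q' + p' * q, q * q', mul_ne_zero hq hq', ?_⟩
  push_cast
  rw [← h, ← h']
  ring

theorem polynomial_mul (p : ℤ[X]) (hf : IsRationalSeries f) :
    IsRationalSeries ((p : ℤ⟦X⟧) * f) := by
  obtain ⟨p', q, hq, h⟩ := hf
  exact ⟨p * p', q, hq, by rw [mul_left_comm, h, Polynomial.coe_mul]⟩

theorem of_polynomial_mul {p : ℤ[X]} (hp : p ≠ 0) (hf : IsRationalSeries ((p : ℤ⟦X⟧) * f)) :
    IsRationalSeries f := by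
  obtain ⟨p', q, hq, h⟩ := hf
  exact ⟨p', q * p, mul_ne_zero hq hp, by rw [Polynomial.coe_mul, mul_assoc, h]⟩

theorem sub (hf : IsRationalSeries f) (hg : IsRationalSeries g) : IsRationalSeries (f - g) := by
  simpa [sub_eq_add_neg] using hf.add (hg.polynomial_mul (-1))

end IsRationalSeries

/-! ### Sets with rational growth -/

section Growth

variable {α β : Type*}

/-- The series whose `n`-th coefficient is the number of elements of `s` of weight `n`. As `ncard`
counts infinite sets as `0`, it is meaningful only if there are finitely many of them. -/
noncomputable def countingSeries (wt : α → ℕ) (s : Set α) : ℤ⟦X⟧ :=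
  PowerSeries.mk fun n => ((s ∩ wt ⁻¹' {n}).ncard : ℤ)

/-- A set has rational growth with respect to a weight if it has finitely many elements of each
weight and the generating function of their numbers is rational. -/
def HasRationalGrowth (wt : α → ℕ) (s : Set α) : Prop :=
  (∀ n, (s ∩ wt ⁻¹' {n}).Finite) ∧ IsRationalSeries (countingSeries wt s)

variable {wt : α → ℕ} {wt' : β → ℕ} {s t : Set α}

@[simp]
theorem countingSeries_empty (wt : α → ℕ) : countingSeries wt ∅ = 0 := by
  ext n
  simp [countingSeries]

theorem countingSeries_union_add_inter (hs : ∀ n, (s ∩ wt ⁻¹' {n}).Finite)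
    (ht : ∀ n, (t ∩ wt ⁻¹' {n}).Finite) :
    countingSeries wt (s ∪ t) + countingSeries wt (s ∩ t) =
      countingSeries wt s + countingSeries wt t := by
  ext n
  simp only [countingSeries, map_add, PowerSeries.coeff_mk]
  norm_cast
  rw [Set.union_inter_distrib_right, Set.inter_inter_distrib_right]
  exact Set.ncard_union_add_ncard_inter _ _ (hs n) (ht n)

theorem countingSeries_union (hs : ∀ n, (s ∩ wt ⁻¹' {n}).Finite)
    (ht : ∀ n, (t ∩ wt ⁻¹' {n}).Finite) (hst : Disjoint s t) :
    countingSeries wt (s ∪ t) = countingSeries wt s + countingSeries wt t := by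
  simpa [hst.inter_eq] using countingSeries_union_add_inter hs ht

section Image

variable {f : β → α} {d : ℕ} {u : Set β}

theorem image_inter_preimage_weight (hf : ∀ y ∈ u, wt (f y) = d + wt' y) (n : ℕ) :
    f '' u ∩ wt ⁻¹' {n} = f '' (u ∩ {y | d + wt' y = n}) := by
  rw [← Set.image_inter_preimage]
  congr 1
  ext y
  exact and_congr_right fun hy => by simp [hf y hy]

theorem countingSeries_image (hf : ∀ y ∈ u, wt (f y) = d + wt' y) (hu : u.InjOn f) :
    countingSeries wt (f '' u) = (Polynomial.X ^ d : ℤ[X]) * countingSeries wt' u := by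
  ext n
  rw [Polynomial.coe_pow, Polynomial.coe_X, PowerSeries.coeff_X_pow_mul', countingSeries,
    countingSeries, PowerSeries.coeff_mk, image_inter_preimage_weight hf,
    (hu.mono Set.inter_subset_left).ncard_image]
  split_ifs with hdn
  · rw [PowerSeries.coeff_mk]
    congr! 3
    ext y
    simp only [Set.mem_ofPred_eq, Set.mem_preimage, Set.mem_singleton_iff]
    omega
  · have : {y | d + wt' y = n} = ∅ :=
      Set.eq_empty_of_forall_notMem fun y hy => hdn (Nat.le.intro hy)
    simp [this]

end Image

namespace HasRationalGrowth

theorem empty (wt : α → ℕ) : HasRationalGrowth wt ∅ :=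
  ⟨fun n => by simp, by simpa using IsRationalSeries.of_polynomial 0⟩

theorem singleton (wt : α → ℕ) (x : α) : HasRationalGrowth wt {x} := by
  refine ⟨fun n => (Set.finite_singleton x).inter_of_left _, ?_⟩
  convert IsRationalSeries.of_polynomial (Polynomial.X ^ wt x)
  ext n
  simp only [countingSeries, PowerSeries.coeff_mk, Polynomial.coeff_coe, Polynomial.coeff_X_pow]
  split_ifs with h
  · rw [Set.inter_eq_left.2 (by simp [h]), Set.ncard_singleton, Nat.cast_one]
  · rw [Set.singleton_inter_eq_empty.2 (by simpa [eq_comm] using h), Set.ncard_empty, Nat.cast_zero]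

theorem union_of_inter (hs : HasRationalGrowth wt s) (ht : HasRationalGrowth wt t)
    (hst : HasRationalGrowth wt (s ∩ t)) : HasRationalGrowth wt (s ∪ t) := by
  constructor
  · intro n
    rw [Set.union_inter_distrib_right]
    exact (hs.1 n).union (ht.1 n)
  · rw [eq_sub_of_add_eq (countingSeries_union_add_inter hs.1 ht.1)]
    exact (hs.2.add ht.2).sub hst.2

theorem union (hs : HasRationalGrowth wt s) (ht : HasRationalGrowth wt t) (hst : Disjoint s t) :
    HasRationalGrowth wt (s ∪ t) :=
  hs.union_of_inter ht (hst.inter_eq ▸ empty wt)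

theorem sdiff (hs : HasRationalGrowth wt s) (ht : HasRationalGrowth wt t) (hts : t ⊆ s) :
    HasRationalGrowth wt (s \ t) := by
  have hfin (n : ℕ) : ((s \ t) ∩ wt ⁻¹' {n}).Finite :=
    (hs.1 n).subset (Set.inter_subset_inter_left _ Set.sdiff_subset)
  have h := countingSeries_union hfin ht.1 Set.disjoint_sdiff_left
  rw [Set.sdiff_union_of_subset hts] at h
  exact ⟨hfin, by rw [eq_sub_of_add_eq h.symm]; exact hs.2.sub ht.2⟩

theorem image {u : Set β} (hu : HasRationalGrowth wt' u) {f : β → α} (hinj : u.InjOn f) {d : ℕ}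
    (hf : ∀ y ∈ u, wt (f y) = d + wt' y) : HasRationalGrowth wt (f '' u) := by
  constructor
  · intro n
    rw [image_inter_preimage_weight hf]
    refine ((hu.1 (n - d)).subset ?_).image f
    exact Set.inter_subset_inter_right _ fun y hy => (Nat.sub_eq_of_eq_add' hy.symm).symm
  · rw [countingSeries_image hf hinj]
    exact hu.2.polynomial_mul _

theorem sUnion {C : Set (Set α)} (hC : C.Finite) (hrat : ∀ s ∈ C, HasRationalGrowth wt s)
    (hdisj : C.PairwiseDisjoint id) : HasRationalGrowth wt (⋃₀ C) := by
  induction C, hC using Set.Finite.induction_on with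
  | empty => simpa using empty wt
  | @insert a C ha _ ih =>
    rw [Set.forall_mem_insert] at hrat
    rw [Set.pairwiseDisjoint_insert_of_notMem ha] at hdisj
    rw [Set.sUnion_insert]
    exact hrat.1.union (ih hrat.2 hdisj.1) (Set.disjoint_sUnion_right.2 hdisj.2)

theorem biUnion {C : Set (Set α)} (hC : ∀ s ∈ C, ∀ t ∈ C, s ∩ t ∈ C)
    (hrat : ∀ s ∈ C, HasRationalGrowth wt s) {ι : Type*} {I : Set ι} (hI : I.Finite)
    {s : ι → Set α} (hs : ∀ i ∈ I, s i ∈ C) : HasRationalGrowth wt (⋃ i ∈ I, s i) := by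
  induction I, hI using Set.Finite.induction_on generalizing s with
  | empty => simpa using empty wt
  | @insert a I _ _ ih =>
    rw [Set.forall_mem_insert] at hs
    rw [Set.biUnion_insert]
    refine (hrat _ hs.1).union_of_inter (ih hs.2) ?_
    rw [Set.inter_iUnion₂]
    exact ih fun i hi => hC _ hs.1 _ (hs.2 i hi)

theorem of_eq_union_image {s₀ : Set α} (hs₀ : HasRationalGrowth wt s₀) {f : α → α} {d : ℕ}
    (hd : 0 < d) (hf : ∀ x ∈ s, wt (f x) = d + wt x) (hinj : s.InjOn f) (hs : s = s₀ ∪ f '' s)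
    (hdisj : Disjoint s₀ (f '' s)) : HasRationalGrowth wt s := by
  have hfin (n : ℕ) : (s ∩ wt ⁻¹' {n}).Finite := by
    induction n using Nat.strong_induction_on with | _ n ih =>
    have hlt : s ∩ {x | d + wt x = n} ⊆ ⋃ m ∈ Set.Iio n, s ∩ wt ⁻¹' {m} := fun x hx =>
      Set.mem_biUnion (show wt x < n by have : d + wt x = n := hx.2; omega) ⟨hx.1, rfl⟩
    rw [hs, Set.union_inter_distrib_right, image_inter_preimage_weight hf]
    exact (hs₀.1 n).union ((((Set.finite_Iio n).biUnion ih).subset hlt).image f)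
  have hfin' (n : ℕ) : (f '' s ∩ wt ⁻¹' {n}).Finite :=
    (hfin n).subset (Set.inter_subset_inter_left _ (Set.subset_union_right.trans hs.ge))
  have hne : (1 - Polynomial.X ^ d : ℤ[X]) ≠ 0 := by
    intro h
    simpa [hd.ne'] using congrArg (Polynomial.eval 0) h
  have hseries : countingSeries wt s =
      countingSeries wt s₀ + (Polynomial.X ^ d : ℤ[X]) * countingSeries wt s := by
    conv_lhs => rw [hs, countingSeries_union hs₀.1 hfin' hdisj, countingSeries_image hf hinj]
  refine ⟨hfin, .of_polynomial_mul hne ?_⟩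
  rw [Polynomial.coe_sub, Polynomial.coe_one, sub_mul, one_mul, sub_eq_of_eq_add hseries]
  exact hs₀.2

end HasRationalGrowth

end Growth

/-! ### Growth of subsets of `ℕ ^ k` -/

section Pi

variable {κ : Type*} [DecidableEq κ] {wt : (κ → ℕ) →+ ℕ}

theorem hasRationalGrowth_setOf_support_subset (hwt : ∀ j, 0 < wt (Pi.single j 1))
    (J : Finset κ) : HasRationalGrowth wt {y | ∀ j ∉ J, y j = 0} := by
  induction J using Finset.induction_on with
  | empty =>
    convert HasRationalGrowth.singleton wt 0
    ext y
    simp [funext_iff]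
  | insert a J ha ih =>
    refine ih.of_eq_union_image (hwt a) (fun y _ => map_add wt (Pi.single a 1) y)
      (add_right_injective _).injOn ?_ ?_
    · ext y
      simp only [Set.mem_union, Set.mem_image, Set.mem_ofPred_eq, Finset.mem_insert, not_or]
      constructor
      · intro hy
        obtain hya | hya := Nat.eq_zero_or_pos (y a)
        · exact .inl fun j hj => (eq_or_ne j a).elim (· ▸ hya) fun hja => hy j ⟨hja, hj⟩
        · refine .inr ⟨y - Pi.single a 1, fun j hj => by simp [hy j hj], ?_⟩
          ext j
          obtain rfl | hja := eq_or_ne j a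
          · simp [Nat.add_sub_cancel' hya]
          · simp [hja]
      · rintro (hy | ⟨y, hy, rfl⟩) j hj
        · exact hy j hj.2
        · simp [hj.1, hy j hj]
    · rw [Set.disjoint_left]
      rintro _ hy ⟨y, -, rfl⟩
      simpa using hy a ha

variable [Finite κ]

theorem hasRationalGrowth_univ_pi (hwt : ∀ j, 0 < wt (Pi.single j 1)) :
    HasRationalGrowth wt Set.univ := by
  have := Fintype.ofFinite κ
  convert hasRationalGrowth_setOf_support_subset hwt Finset.univ
  simp

theorem hasRationalGrowth_Ici (hwt : ∀ j, 0 < wt (Pi.single j 1)) (c : κ → ℕ) :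
    HasRationalGrowth wt (Set.Ici c) := by
  convert (hasRationalGrowth_univ_pi hwt).image (add_right_injective c).injOn
    fun y _ => map_add wt c y
  ext x
  simp only [Set.mem_Ici, le_iff_exists_add, Set.image_univ, Set.mem_range, eq_comm]

theorem hasRationalGrowth_of_isUpperSet (hwt : ∀ j, 0 < wt (Pi.single j 1)) {s : Set (κ → ℕ)}
    (hs : IsUpperSet s) : HasRationalGrowth wt s := by
  have hmin : {x | Minimal (· ∈ s) x}.Finite :=
    WellQuasiOrderedLE.finite_of_isAntichain (setOfPred_minimal_antichain _)
  have hs_eq : s = ⋃ c ∈ {x | Minimal (· ∈ s) x}, Set.Ici c := by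
    ext x
    simp only [Set.mem_ofPred_eq, Set.mem_iUnion, Set.mem_Ici, exists_prop]
    constructor
    · intro hx
      obtain ⟨c, hcx, hc⟩ := (Set.isPWO_of_wellQuasiOrderedLE s).exists_le_minimal hx
      exact ⟨c, hc, hcx⟩
    · rintro ⟨c, hc, hcx⟩
      exact hs hcx hc.1
  rw [hs_eq]
  refine HasRationalGrowth.biUnion (C := Set.range Set.Ici) ?_ ?_ hmin fun c _ => ⟨c, rfl⟩
  · rintro _ ⟨c, rfl⟩ _ ⟨d, rfl⟩
    exact ⟨c ⊔ d, Set.Ici_inter_Ici.symm⟩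
  · rintro _ ⟨c, rfl⟩
    exact hasRationalGrowth_Ici hwt c

theorem hasRationalGrowth_of_isLowerSet (hwt : ∀ j, 0 < wt (Pi.single j 1)) {s : Set (κ → ℕ)}
    (hs : IsLowerSet s) : HasRationalGrowth wt s := by
  rw [← compl_compl s, Set.compl_eq_univ_sdiff]
  exact (hasRationalGrowth_univ_pi hwt).sdiff (hasRationalGrowth_of_isUpperSet hwt hs.compl)
    (Set.subset_univ _)

end Pi

/-! ### Finite unions of translates of a submonoid -/

section Translates

variable {M : Type*} [AddCommMonoid M] {wt : M →+ ℕ}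

/-- A finite union of translates of one finitely generated submonoid whose nonzero elements have
positive weight. -/
def IsPositiveTranslateUnion (wt : M →+ ℕ) (s : Set M) : Prop :=
  ∃ P : AddSubmonoid M, P.FG ∧ (∀ x ∈ P, wt x = 0 → x = 0) ∧
    ∃ C : Set M, C.Finite ∧ s = C + (P : Set M)

theorem exists_finite_setOf_add_map_eq [IsCancelAdd M] {N : Type*} [AddCommMonoid N]
    [PartialOrder N] [CanonicallyOrderedAdd N] [WellQuasiOrderedLE N]
    (f g : N →+ M) (c d : M) :
    ∃ B : Set N, B.Finite ∧ {x | c + f x = d + g x} = B + (f.eqLocusM g : Set N) := by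
  let Z := {x | c + f x = d + g x}
  refine ⟨{x | Minimal (· ∈ Z) x},
    WellQuasiOrderedLE.finite_of_isAntichain (setOfPred_minimal_antichain _), ?_⟩
  ext x
  constructor
  · intro hx
    obtain ⟨b, hbx, hb⟩ := (Set.isPWO_of_wellQuasiOrderedLE Z).exists_le_minimal hx
    obtain ⟨e, rfl⟩ := le_iff_exists_add.1 hbx
    have hbZ : c + f b = d + g b := hb.1
    have hbeZ : c + f (b + e) = d + g (b + e) := hx
    rw [map_add, map_add, ← add_assoc, ← add_assoc, hbZ] at hbeZ
    exact ⟨b, hb, e, add_left_cancel hbeZ, rfl⟩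
  · rintro ⟨b, hb, e, he, rfl⟩
    have hbZ : c + f b = d + g b := hb.1
    have hfe : f e = g e := he
    simp only [Set.mem_ofPred_eq, map_add, ← add_assoc, hbZ, hfe]

theorem IsPositiveTranslateUnion.inter [IsCancelAdd M] {s t : Set M}
    (hs : IsPositiveTranslateUnion wt s) (ht : IsPositiveTranslateUnion wt t) :
    IsPositiveTranslateUnion wt (s ∩ t) := by
  obtain ⟨P, hP, hpos, C, hC, rfl⟩ := hs
  obtain ⟨Q, hQ, -, D, hD, rfl⟩ := ht
  obtain ⟨m, f, rfl⟩ := AddSubmonoid.fg_iff_exists_fin_addMonoidHom.1 hP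
  obtain ⟨n, g, rfl⟩ := AddSubmonoid.fg_iff_exists_fin_addMonoidHom.1 hQ
  let f' : (Fin m → ℕ) × (Fin n → ℕ) →+ M := f.comp (AddMonoidHom.fst _ _)
  let g' : (Fin m → ℕ) × (Fin n → ℕ) →+ M := g.comp (AddMonoidHom.snd _ _)
  choose B hBfin hB using exists_finite_setOf_add_map_eq f' g'
  refine ⟨(f'.eqLocusM g').map f', (AddSubmonoid.fg_eqLocusM f' g').map f', ?_,
    ⋃ p ∈ C ×ˢ D, (p.1 + f' ·) '' B p.1 p.2,
    (hC.prod hD).biUnion fun p _ => (hBfin p.1 p.2).image _, ?_⟩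
  · rintro _ ⟨e, -, rfl⟩
    exact hpos _ ⟨e.1, rfl⟩
  ext x
  constructor
  · rintro ⟨⟨c, hc, _, ⟨u, rfl⟩, rfl⟩, ⟨d, hd, _, ⟨v, rfl⟩, h⟩⟩
    obtain ⟨b, hb, e, he, hbe⟩ := (hB c d).le (show c + f' (u, v) = d + g' (u, v) from h.symm)
    refine ⟨c + f' b, Set.mem_biUnion (Set.mk_mem_prod hc hd) ⟨b, hb, rfl⟩, f' e, ⟨e, he, rfl⟩, ?_⟩
    have hfbe : f' (b + e) = f u := congrArg f' hbe
    simp only [add_assoc, ← map_add, hfbe]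
  · rintro ⟨_, hy, _, ⟨e, he, rfl⟩, rfl⟩
    obtain ⟨⟨c, d⟩, ⟨hc, hd⟩, b, hb, rfl⟩ := Set.mem_iUnion₂.1 hy
    have hbe : c + f' (b + e) = d + g' (b + e) := (hB c d).ge ⟨b, hb, e, he, rfl⟩
    simp only [add_assoc, ← map_add]
    exact ⟨⟨c, hc, f' (b + e), ⟨_, rfl⟩, rfl⟩, ⟨d, hd, g' (b + e), ⟨_, rfl⟩, hbe.symm⟩⟩

section LexLeast

variable {κ : Type*} [LinearOrder κ] {f : (κ → ℕ) →+ M} {V : Set M} {c : M}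

/-- The vectors that represent an element of `c + range f` outside `V` and are lexicographically
least with this property. -/
def lexLeastReps (f : (κ → ℕ) →+ M) (V : Set M) (c : M) : Set (κ → ℕ) :=
  {y | c + f y ∉ V ∧ ∀ y', c + f y' = c + f y → toLex y ≤ toLex y'}

theorem isLowerSet_lexLeastReps (hV : ∀ v ∈ V, ∀ y, v + f y ∈ V) :
    IsLowerSet (lexLeastReps f V c) := by
  intro z y hyz hz
  obtain ⟨e, rfl⟩ := le_iff_exists_add.1 hyz
  constructor
  · intro hy
    refine hz.1 ?_
    rw [map_add, ← add_assoc]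
    exact hV _ hy e
  · intro y' hy'
    have h := hz.2 (y' + e) (by rw [map_add, map_add, ← add_assoc, hy', add_assoc])
    rwa [toLex_add, toLex_add, add_le_add_iff_right] at h

theorem injOn_lexLeastReps : (lexLeastReps f V c).InjOn (c + f ·) := fun y hy z hz h =>
  toLex.injective (le_antisymm (hy.2 z h.symm) (hz.2 y h))

theorem image_lexLeastReps [Finite κ] :
    (c + f ·) '' lexLeastReps f V c = Set.range (c + f ·) \ V := by
  ext x
  constructor
  · rintro ⟨y, hy, rfl⟩
    exact ⟨⟨y, rfl⟩, hy.1⟩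
  · rintro ⟨⟨y, rfl⟩, hy⟩
    obtain ⟨z, hz, hmin⟩ := WellFounded.has_min (wellFounded_lt (α := Lex (κ → ℕ)))
      {z | c + f (ofLex z) = c + f y} ⟨toLex y, rfl⟩
    exact ⟨ofLex z, ⟨fun h => hy (Set.mem_of_eq_of_mem hz.symm h),
      fun y' hy' => not_lt.1 (hmin (toLex y') (hy'.trans hz))⟩, hz⟩

theorem HasRationalGrowth.union_range_add_map [Finite κ] (hf : ∀ y, wt (f y) = 0 → y = 0)
    (hV : ∀ v ∈ V, ∀ y, v + f y ∈ V) (hrat : HasRationalGrowth wt V) (c : M) :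
    HasRationalGrowth wt (V ∪ Set.range (c + f ·)) := by
  have hwt (j : κ) : 0 < (wt.comp f) (Pi.single j 1) :=
    Nat.pos_of_ne_zero fun h => one_ne_zero (Pi.single_eq_zero_iff.1 (hf _ h))
  rw [← Set.union_sdiff_self, ← image_lexLeastReps]
  refine hrat.union ((hasRationalGrowth_of_isLowerSet hwt (isLowerSet_lexLeastReps hV)).image
    injOn_lexLeastReps fun y _ => map_add wt c (f y)) ?_
  rw [image_lexLeastReps]
  exact Set.disjoint_sdiff_right

end LexLeast

theorem exists_addMonoidHom_mrange_eq {P : AddSubmonoid M} (hP : P.FG)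
    (hpos : ∀ x ∈ P, wt x = 0 → x = 0) :
    ∃ (n : ℕ) (f : (Fin n → ℕ) →+ M), AddMonoidHom.mrange f = P ∧ ∀ y, wt (f y) = 0 → y = 0 := by
  obtain ⟨t, rfl⟩ := hP
  obtain ⟨n, v, -, hv⟩ := (t.finite_toSet.subset (Set.sdiff_subset (t := {0}))).fin_param
  refine ⟨n, (Fintype.linearCombination ℕ v).toAddMonoidHom, ?_, fun y hy => funext fun i => ?_⟩
  · rw [← AddSubmonoid.closure_sdiff_singleton_zero, ← hv,
      ← Submodule.span_nat_eq_addSubmonoidClosure, ← Fintype.range_linearCombination]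
    rfl
  · have hyi : y i * wt (v i) = 0 := by
      have hsum : ∑ i, y i * wt (v i) = 0 := by
        simpa [Fintype.linearCombination_apply] using hy
      exact Finset.sum_eq_zero_iff.1 hsum i (Finset.mem_univ i)
    have hvi : v i ∈ (t : Set M) \ {0} := hv ▸ Set.mem_range_self i
    exact (mul_eq_zero.1 hyi).resolve_right fun h =>
      hvi.2 (hpos _ (AddSubmonoid.subset_closure hvi.1) h)

theorem IsPositiveTranslateUnion.hasRationalGrowth {s : Set M}
    (hs : IsPositiveTranslateUnion wt s) : HasRationalGrowth wt s := by
  obtain ⟨P, hP, hpos, C, hC, rfl⟩ := hs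
  obtain ⟨n, f, rfl, hf⟩ := exists_addMonoidHom_mrange_eq hP hpos
  induction C, hC using Set.Finite.induction_on with
  | empty => simpa using HasRationalGrowth.empty wt
  | @insert c C _ _ ih =>
    have hrange : (fun x => c + x) '' (AddMonoidHom.mrange f : Set M) = Set.range (c + f ·) := by
      rw [AddMonoidHom.coe_mrange, ← Set.range_comp]
      rfl
    rw [Set.insert_eq, Set.union_add, Set.union_comm, Set.singleton_add, hrange]
    refine ih.union_range_add_map hf ?_ c
    rintro _ ⟨a, ha, x, hx, rfl⟩ y
    exact ⟨a, ha, x + f y, add_mem hx ⟨y, rfl⟩, (add_assoc _ _ _).symm⟩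

theorem eq_zero_of_mem_closure_of_weight_eq_zero {t : Set M} (ht : ∀ x ∈ t, wt x ≠ 0) {x : M}
    (hx : x ∈ AddSubmonoid.closure t) : wt x = 0 → x = 0 := by
  induction hx using AddSubmonoid.closure_induction with
  | mem x hx => exact fun h => absurd h (ht x hx)
  | zero => exact fun _ => rfl
  | add x y _ _ ihx ihy =>
    intro h
    rw [map_add, Nat.add_eq_zero_iff] at h
    rw [ihx h.1, ihy h.2, add_zero]

theorem isPositiveTranslateUnion_of_isLinearSet {s : Set M} (hs : IsLinearSet s)
    (hfin : ∀ n, (s ∩ wt ⁻¹' {n}).Finite) : IsPositiveTranslateUnion wt s := by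
  obtain ⟨a, t, ht, rfl⟩ := hs
  -- The generators of weight zero generate a finite submonoid, which is absorbed into the set of
  -- translation vectors.
  let t₀ := t ∩ wt ⁻¹' {0}
  let t₁ := t \ wt ⁻¹' {0}
  have hclosure : AddSubmonoid.closure t = AddSubmonoid.closure t₀ ⊔ AddSubmonoid.closure t₁ := by
    rw [← AddSubmonoid.closure_union, Set.inter_union_sdiff]
  have hweight : AddSubmonoid.closure t₀ ≤ AddMonoidHom.mker wt :=
    (AddSubmonoid.closure_le).2 fun x hx => hx.2
  refine ⟨AddSubmonoid.closure t₁, (AddSubmonoid.fg_iff _).2 ⟨t₁, rfl, ht.sdiff⟩,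
    fun x => eq_zero_of_mem_closure_of_weight_eq_zero fun y hy => hy.2,
    a +ᵥ (AddSubmonoid.closure t₀ : Set M), (hfin (wt a)).subset ?_, ?_⟩
  · rintro _ ⟨x, hx, rfl⟩
    refine ⟨⟨x, AddSubmonoid.closure_mono Set.inter_subset_left hx, rfl⟩, ?_⟩
    have hx0 : wt x = 0 := hweight hx
    simp [hx0]
  · rw [hclosure, AddSubmonoid.coe_sup, vadd_add_assoc]

theorem hasRationalGrowth_of_isSemilinearSet [IsCancelAdd M] {s : Set M}
    (hs : IsSemilinearSet s) (hfin : ∀ n, (s ∩ wt ⁻¹' {n}).Finite) : HasRationalGrowth wt s := by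
  obtain ⟨S, hS, rfl⟩ := isSemilinearSet_iff.1 hs
  rw [Set.sUnion_eq_biUnion] at hfin ⊢
  refine HasRationalGrowth.biUnion (C := {t | IsPositiveTranslateUnion wt t})
    (fun _ hs _ ht => IsPositiveTranslateUnion.inter hs ht)
    (fun _ => IsPositiveTranslateUnion.hasRationalGrowth) S.finite_toSet fun t ht => ?_
  exact isPositiveTranslateUnion_of_isLinearSet (hS t ht) fun n =>
    (hfin n).subset (Set.inter_subset_inter_left _ (Set.subset_biUnion_of_mem (u := id) ht))

end Translates

/-! ### Least values over the fibres of a semilinear set -/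

theorem hasRationalGrowth_of_epigraph {α : Type*} {W : α → ℕ}
    (hW : HasRationalGrowth Prod.snd {p : α × ℕ | W p.1 ≤ p.2}) :
    HasRationalGrowth W Set.univ := by
  set epigraph := {p : α × ℕ | W p.1 ≤ p.2}
  let shift : α × ℕ → α × ℕ := fun p => (p.1, 1 + p.2)
  have hshift_inj : shift.Injective := fun p q h => by simpa [shift, Prod.ext_iff] using h
  have hshift_subset : shift '' epigraph ⊆ epigraph := by
    rintro _ ⟨p, hp, rfl⟩
    exact Nat.le_add_left_of_le hp
  have hgraph : epigraph \ shift '' epigraph = {p | W p.1 = p.2} := by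
    ext ⟨x, n⟩
    constructor
    · rintro ⟨hx, hx'⟩
      refine (show W x ≤ n from hx).eq_of_not_lt fun hlt => hx' ⟨(x, n - 1), ?_, ?_⟩
      · exact Nat.le_sub_one_of_lt hlt
      · exact Prod.ext rfl (Nat.add_sub_of_le (Nat.one_le_of_lt hlt))
    · rintro (rfl : W x = n)
      refine ⟨le_refl (W x), ?_⟩
      rintro ⟨⟨y, m⟩, hy, h⟩
      obtain ⟨rfl, h⟩ := Prod.mk.inj h
      exact absurd (show W y ≤ m from hy) (by change 1 + m = W y at h; omega)
  have hfst_inj : Set.InjOn Prod.fst {p : α × ℕ | W p.1 = p.2} := fun p hp q hq h =>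
    Prod.ext h (by rw [← hp, ← hq, h])
  have hfst_image : Prod.fst '' {p : α × ℕ | W p.1 = p.2} = Set.univ :=
    Set.eq_univ_of_forall fun x => ⟨(x, W x), rfl, rfl⟩
  rw [← hfst_image]
  refine HasRationalGrowth.image ?_ hfst_inj (d := 0) fun p hp => hp.trans (zero_add _).symm
  rw [← hgraph]
  exact hW.sdiff (hW.image hshift_inj.injOn fun _ _ => rfl) hshift_subset

theorem hasRationalGrowth_of_isLeast_fibre {M : Type*} [AddCommMonoid M] [IsCancelAdd M]
    {D : Set (M × ℕ)} (hD : IsSemilinearSet D) {W : M → ℕ}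
    (hleast : ∀ x, IsLeast {n | (x, n) ∈ D} (W x)) (hfin : ∀ n, (W ⁻¹' {n}).Finite) :
    HasRationalGrowth W Set.univ := by
  have hD_add : {p : M × ℕ | W p.1 ≤ p.2} = D + AddMonoidHom.inr M ℕ '' Set.univ := by
    ext ⟨x, n⟩
    constructor
    · intro hx
      obtain ⟨k, rfl⟩ := le_iff_exists_add.1 (show W x ≤ n from hx)
      exact ⟨(x, W x), (hleast x).1, (0, k), ⟨k, trivial, rfl⟩, by simp⟩
    · rintro ⟨⟨y, m⟩, hy, _, ⟨k, -, rfl⟩, h⟩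
      obtain ⟨rfl, rfl⟩ : y = x ∧ m + k = n := by simpa using h
      exact ((hleast y).2 hy).trans (Nat.le_add_right m k)
  have hsemi : IsSemilinearSet {p : M × ℕ | W p.1 ≤ p.2} :=
    hD_add ▸ hD.add (IsSemilinearSet.univ.image _)
  refine hasRationalGrowth_of_epigraph
    (hasRationalGrowth_of_isSemilinearSet (wt := AddMonoidHom.snd M ℕ) hsemi fun n => ?_)
  refine (((Set.finite_Iic n).biUnion fun m _ => hfin m).prod (Set.finite_singleton n)).subset ?_
  rintro ⟨x, m⟩ ⟨hx, rfl⟩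
  exact ⟨Set.mem_biUnion (Set.mem_Iic.2 hx) rfl, rfl⟩

/-! ### Kleene's algorithm in a commutative monoid -/

section Path

variable {V E M : Type*} [AddCommMonoid M]

/-- `PathSum src tgt lab U p q v` says that `v` is the sum of the labels along a nonempty path from
`p` to `q` all of whose intermediate vertices are in `U`. -/
inductive PathSum (src tgt : E → V) (lab : E → M) (U : Set V) : V → V → M → Prop
  | edge (e : E) : PathSum src tgt lab U (src e) (tgt e) (lab e)
  | cons (e : E) {q : V} {v : M} (he : tgt e ∈ U) (h : PathSum src tgt lab U (tgt e) q v) :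
      PathSum src tgt lab U (src e) q (lab e + v)

variable {src tgt : E → V} {lab : E → M} {U : Set V} {p q u : V}

theorem PathSum.mono {U' : Set V} (hU : U ⊆ U') {v : M} (h : PathSum src tgt lab U p q v) :
    PathSum src tgt lab U' p q v := by
  induction h with
  | edge e => exact .edge e
  | cons e he _ ih => exact .cons e (hU he) ih

theorem PathSum.trans {a b : M} (hu : u ∈ U) (h : PathSum src tgt lab U p u a)
    (h' : PathSum src tgt lab U u q b) : PathSum src tgt lab U p q (a + b) := by
  induction h with
  | edge e => exact .cons e hu h'
  | cons e he _ ih => rw [add_assoc]; exact .cons e he (ih hu h')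

theorem setOf_pathSum_insert :
    {v | PathSum src tgt lab (insert u U) p q v} = {v | PathSum src tgt lab U p q v} ∪
      ({v | PathSum src tgt lab U p u v} +
        ((AddSubmonoid.closure {v | PathSum src tgt lab U u u v} : Set M) +
          {v | PathSum src tgt lab U u q v})) := by
  ext v
  constructor
  · intro h
    induction h with
    | edge e => exact .inl (.edge e)
    | @cons e q v he h ih =>
      obtain he | he := he
      · rw [he] at ih
        right
        obtain ih | ⟨a, ha, _, ⟨b, hb, c, hc, rfl⟩, rfl⟩ := ih
        · exact ⟨lab e, he ▸ .edge e, v, ⟨0, zero_mem _, v, ih, zero_add v⟩, rfl⟩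
        · exact ⟨lab e, he ▸ .edge e, a + (b + c),
            ⟨a + b, add_mem (AddSubmonoid.subset_closure ha) hb, c, hc, add_assoc _ _ _⟩, rfl⟩
      · obtain ih | ⟨a, ha, b, hb, rfl⟩ := ih
        · exact .inl (.cons e he ih)
        · exact .inr ⟨lab e + a, .cons e he ha, b, hb, add_assoc _ _ _⟩
  · have hU : U ⊆ insert u U := Set.subset_insert u U
    have hu : u ∈ insert u U := Set.mem_insert u U
    rintro (h | ⟨a, ha, _, ⟨b, hb, c, hc, rfl⟩, rfl⟩)
    · exact h.mono hU
    · refine (PathSum.mono hU ha).trans hu ?_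
      induction hb using AddSubmonoid.closure_induction_left with
      | zero => simpa using PathSum.mono hU hc
      | add_left x hx y _ ih =>
        simp only [add_assoc]
        exact (PathSum.mono hU hx).trans hu ih

theorem isSemilinearSet_pathSum [Finite V] [Finite E] (U : Set V) (p q : V) :
    IsSemilinearSet {v | PathSum src tgt lab U p q v} := by
  induction U, U.toFinite using Set.Finite.induction_on generalizing p q with
  | empty =>
    refine .of_finite ((Set.finite_range lab).subset ?_)
    rintro v (e | ⟨e, he, -⟩)
    · exact ⟨e, rfl⟩
    · exact he.elim
  | insert _ _ ih =>
    rw [setOf_pathSum_insert]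
    exact (ih p q).union ((ih _ _).add ((ih _ _).closure.add (ih _ _)))

end Path

open scoped IsMulCommutative

/-! ### Words as paths in a Schreier graph -/

section Words

variable {G : Type*} {S : Set G} (ω : S → ℕ+)

@[simp]
theorem wordWeight_nil : wordWeight ω [] = 0 := rfl

@[simp]
theorem wordWeight_cons (s : S) (w : List S) :
    wordWeight ω (s :: w) = ω s + wordWeight ω w := by
  simp [wordWeight]

theorem length_le_wordWeight (w : List S) : w.length ≤ wordWeight ω w := by
  induction w with
  | nil => rfl
  | cons s w ih =>
    have := (ω s).pos
    rw [List.length_cons, wordWeight_cons]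
    omega

theorem finite_setOf_wordWeight_eq [Finite S] (n : ℕ) : {w : List S | wordWeight ω w = n}.Finite :=
  (List.finite_length_le S n).subset fun w hw => (length_le_wordWeight ω w).trans_eq hw

variable [Group G]

@[simp]
theorem wordValue_nil : wordValue ([] : List S) = 1 := rfl

@[simp]
theorem wordValue_cons (s : S) (w : List S) : wordValue (s :: w) = s * wordValue w := by
  simp [wordValue]

end Words

section Schreier

variable {G : Type*} [Group G] (A : Subgroup G)

/-- The Schreier cocycle: the element `a` of `A` with `g * q.out = (g • q).out * a`. -/
noncomputable def schreierCocycle (g : G) (q : G ⧸ A) : A :=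
  ⟨(g • q).out⁻¹ * (g * q.out), QuotientGroup.eq.1 <| by
    rw [QuotientGroup.out_eq', ← MulAction.Quotient.coe_smul_out, smul_eq_mul]⟩

theorem mul_out_eq (g : G) (q : G ⧸ A) : g * q.out = (g • q).out * schreierCocycle A g q :=
  (mul_inv_cancel_left _ _).symm

@[simp]
theorem schreierCocycle_one (q : G ⧸ A) : schreierCocycle A 1 q = 1 := by
  simp [schreierCocycle]

theorem schreierCocycle_mul (g h : G) (q : G ⧸ A) :
    schreierCocycle A (g * h) q = schreierCocycle A g (h • q) * schreierCocycle A h q := by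
  ext
  simp [schreierCocycle, mul_smul, mul_assoc]

variable {S : Set G} (ω : S → ℕ+)

/-- The label of an edge `s • q → q` of the Schreier graph of `A`. A word is read from the right,
so that it labels a path that ends at a given vertex. -/
noncomputable def schreierLabel (e : S × G ⧸ A) : Additive A × ℕ :=
  (Additive.ofMul (schreierCocycle A e.1 e.2), ω e.1)

variable [IsMulCommutative A]

theorem exists_word_iff_pathSum (p q : G ⧸ A) (v : Additive A × ℕ) :
    (∃ w : List S, wordValue w • q = p ∧
        (Additive.ofMul (schreierCocycle A (wordValue w) q), wordWeight ω w) = v) ↔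
      (v = 0 ∧ q = p) ∨ PathSum (fun e : S × G ⧸ A => (e.1 : G) • e.2) Prod.snd
        (schreierLabel A ω) Set.univ p q v := by
  constructor
  · rintro ⟨w, rfl, rfl⟩
    induction w with
    | nil => exact .inl (by simp)
    | cons s w ih =>
      right
      have hv : (Additive.ofMul (schreierCocycle A (wordValue (s :: w)) q),
          wordWeight ω (s :: w)) = schreierLabel A ω (s, wordValue w • q) +
            (Additive.ofMul (schreierCocycle A (wordValue w) q), wordWeight ω w) := by
        simp [schreierLabel, schreierCocycle_mul]
      rw [hv, wordValue_cons, mul_smul]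
      obtain ⟨h, h'⟩ | h := ih
      · rw [h, add_zero]
        convert PathSum.edge (s, wordValue w • q)
      · exact .cons (s, wordValue w • q) (Set.mem_univ _) h
  · rintro (⟨rfl, rfl⟩ | h)
    · exact ⟨[], by simp⟩
    · induction h with
      | edge e => exact ⟨[e.1], by simp [schreierLabel]⟩
      | cons e _ _ ih =>
        obtain ⟨w, hw, rfl⟩ := ih
        refine ⟨e.1 :: w, ?_⟩
        simp [schreierLabel, mul_smul, hw, schreierCocycle_mul]

theorem isSemilinearSet_words [Finite S] [A.FiniteIndex] (p q : G ⧸ A) :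
    IsSemilinearSet {v | ∃ w : List S, wordValue w • q = p ∧
      (Additive.ofMul (schreierCocycle A (wordValue w) q), wordWeight ω w) = v} := by
  simp only [exists_word_iff_pathSum]
  refine IsSemilinearSet.union (s₁ := {v | v = 0 ∧ q = p}) ?_ (isSemilinearSet_pathSum _ _ _)
  exact .of_finite ((Set.finite_singleton 0).subset fun v hv => hv.1)

end Schreier

/-! ### Growth of a transitive action -/

section Action

open MulAction

theorem isSemilinearSet_smul_ofQuotientStabilizer_eq {A X : Type*} [CommGroup A] [MulAction A X]
    (x y : X) {T : Set (Additive A × ℕ)} (hT : IsSemilinearSet T) :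
    IsSemilinearSet {v : Additive (A ⧸ stabilizer A x) × ℕ |
      ∃ a : A, (Additive.ofMul a, v.2) ∈ T ∧ a • ofQuotientStabilizer A x v.1.toMul = y} := by
  by_cases hy : y ∈ orbit A x
  · obtain ⟨a₀, rfl⟩ := hy
    let π : Additive A →+ Additive (A ⧸ stabilizer A x) :=
      (QuotientGroup.mk' (stabilizer A x)).toAdditive
    have hsmul (a : A) (b : A ⧸ stabilizer A x) :
        a • ofQuotientStabilizer A x b = a₀ • x ↔ b = (a : A ⧸ stabilizer A x)⁻¹ * a₀ := by
      rw [← ofQuotientStabilizer_smul, ← ofQuotientStabilizer_mk A x a₀,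
        (injective_ofQuotientStabilizer A x).eq_iff, eq_inv_mul_iff_mul_eq]
      rfl
    convert (hT.image (AddMonoidHom.prodMap (-π) (AddMonoidHom.id ℕ))).vadd (π (.ofMul a₀), 0)
      using 1
    ext ⟨b, n⟩
    simp only [hsmul, Set.mem_ofPred_eq, Set.mem_vadd_set, Set.mem_image]
    constructor
    · rintro ⟨a, ha, hb⟩
      refine ⟨_, ⟨_, ha, rfl⟩, Prod.ext ?_ (zero_add n)⟩
      exact (mul_comm (a₀ : A ⧸ stabilizer A x) (a : A ⧸ stabilizer A x)⁻¹).trans hb.symm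
    · rintro ⟨_, ⟨⟨a, m⟩, ha, rfl⟩, h⟩
      obtain ⟨rfl, rfl⟩ := Prod.mk.inj h
      exact ⟨a.toMul, by simpa using ha,
        mul_comm (a₀ : A ⧸ stabilizer A x) (a.toMul : A ⧸ stabilizer A x)⁻¹⟩
  · convert IsSemilinearSet.empty
    rw [Set.eq_empty_iff_forall_notMem]
    rintro v ⟨a, -, h⟩
    exact hy (h ▸ mem_orbit_of_mem_orbit a (ofQuotientStabilizer_mem_orbit A x _))

variable {G X : Type*} [Group G] [MulAction G X] {S : Set G} {ω : S → ℕ+}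
  {x₀ : X} {W : X → ℕ}

theorem finite_preimage_of_isLeast_words [Finite S]
    (hW : ∀ x, IsLeast {n | ∃ w : List S, wordValue w • x = x₀ ∧ wordWeight ω w = n} (W x))
    (n : ℕ) : (W ⁻¹' {n}).Finite := by
  refine ((finite_setOf_wordWeight_eq ω n).image fun w => (wordValue w)⁻¹ • x₀).subset ?_
  rintro x rfl
  obtain ⟨w, hw, hwx⟩ := (hW x).1
  exact ⟨w, hwx, inv_smul_eq_iff.2 hw.symm⟩

theorem finite_range_orbit_subgroup (A : Subgroup G) [A.FiniteIndex]
    (hx₀ : ∀ x : X, ∃ g : G, g • x = x₀) : (Set.range (orbit A : X → Set X)).Finite := by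
  refine (Set.finite_range fun q : G ⧸ A => orbit A (q.out⁻¹ • x₀)).subset ?_
  rintro _ ⟨x, rfl⟩
  obtain ⟨g, rfl⟩ := hx₀ x
  obtain ⟨a, ha⟩ := QuotientGroup.mk_out_eq_mul A g
  refine ⟨g, orbit_eq_iff.2 ⟨a⁻¹, ?_⟩⟩
  simp [ha, mul_smul, Subgroup.smul_def]

variable (A : Subgroup G) [A.FiniteIndex] [IsMulCommutative A] [Finite S]

theorem isSemilinearSet_words_smul_ofQuotientStabilizer (x x₀ : X) (ω : S → ℕ+) :
    IsSemilinearSet {v : Additive (A ⧸ stabilizer A x) × ℕ | ∃ w : List S,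
      wordValue w • ofQuotientStabilizer A x v.1.toMul = x₀ ∧ wordWeight ω w = v.2} := by
  let q : G ⧸ A := (1 : G)
  obtain ⟨a₁, ha₁⟩ := QuotientGroup.mk_out_eq_mul A 1
  convert IsSemilinearSet.iUnion fun p : G ⧸ A => isSemilinearSet_smul_ofQuotientStabilizer_eq x
    (a₁ • p.out⁻¹ • x₀) (isSemilinearSet_words A ω p q) using 1
  ext ⟨b, n⟩
  have hsmul (w : List S) : wordValue w • ofQuotientStabilizer A x b.toMul = x₀ ↔
      schreierCocycle A (wordValue w) q • ofQuotientStabilizer A x b.toMul =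
        a₁ • (wordValue w • q).out⁻¹ • x₀ := by
    have hval : wordValue w =
        (wordValue w • q).out * schreierCocycle A (wordValue w) q * (a₁ : G)⁻¹ := by
      rw [eq_mul_inv_iff_mul_eq, ← mul_out_eq, ha₁, one_mul]
    conv_lhs => rw [hval]
    rw [mul_smul, mul_smul, ← eq_inv_smul_iff (g := (wordValue w • q).out),
      ← Subgroup.coe_inv, ← Subgroup.smul_def, ← Subgroup.smul_def, smul_comm,
      inv_smul_eq_iff]
  simp only [Set.mem_ofPred_eq, Set.mem_iUnion, hsmul]
  constructor
  · rintro ⟨w, hw, rfl⟩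
    exact ⟨wordValue w • q, _, ⟨w, rfl, rfl⟩, hw⟩
  · rintro ⟨_, _, ⟨w, rfl, hw⟩, h⟩
    obtain ⟨rfl, rfl⟩ := Prod.mk.inj hw
    exact ⟨w, h, rfl⟩

theorem hasRationalGrowth_orbit
    (hW : ∀ x, IsLeast {n | ∃ w : List S, wordValue w • x = x₀ ∧ wordWeight ω w = n} (W x))
    (x : X) : HasRationalGrowth W (orbit A x) := by
  let φ : Additive (A ⧸ stabilizer A x) → X := fun b => ofQuotientStabilizer A x b.toMul
  have hφ : φ.Injective := injective_ofQuotientStabilizer A x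
  have hrange : φ '' Set.univ = orbit A x := by
    rw [Set.image_univ]
    refine (Set.range_subset_iff.2 fun b => ofQuotientStabilizer_mem_orbit A x _).antisymm ?_
    rintro _ ⟨a, rfl⟩
    exact ⟨.ofMul a, ofQuotientStabilizer_mk A x a⟩
  rw [← hrange]
  refine HasRationalGrowth.image ?_ hφ.injOn (wt' := W ∘ φ) (d := 0) fun b _ => (zero_add _).symm
  exact hasRationalGrowth_of_isLeast_fibre
    (isSemilinearSet_words_smul_ofQuotientStabilizer A x x₀ ω) (fun b => hW (φ b))
    fun n => (finite_preimage_of_isLeast_words hW n).preimage (f := φ) hφ.injOn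

include A in
theorem hasRationalGrowth_of_isLeast_words
    (hW : ∀ x, IsLeast {n | ∃ w : List S, wordValue w • x = x₀ ∧ wordWeight ω w = n} (W x)) :
    HasRationalGrowth W Set.univ := by
  have hx₀ (x : X) : ∃ g : G, g • x = x₀ :=
    let ⟨w, hw, _⟩ := (hW x).1
    ⟨wordValue w, hw⟩
  have hunion : ⋃₀ Set.range (orbit A : X → Set X) = Set.univ :=
    Set.eq_univ_of_forall fun x => ⟨_, ⟨x, rfl⟩, mem_orbit_self x⟩
  rw [← hunion]
  refine HasRationalGrowth.sUnion (finite_range_orbit_subgroup A hx₀) ?_ orbit.pairwiseDisjoint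
  rintro _ ⟨x, rfl⟩
  exact hasRationalGrowth_orbit A hW x

end Action

/-! ### Cosets -/

section Cosets

variable {G : Type*} [Group G] {S : Set G}

theorem exists_wordValue_eq (hgen : Submonoid.closure S = ⊤) (g : G) :
    ∃ w : List S, wordValue w = g := by
  obtain ⟨l, hl, rfl⟩ := Submonoid.exists_list_of_mem_closure (hgen ▸ Submonoid.mem_top g)
  lift l to List S using hl
  exact ⟨l, by simp [wordValue]⟩

theorem isLeast_elementWeight (hgen : Submonoid.closure S = ⊤) (ω : S → ℕ+) (g : G) :
    IsLeast {n | ∃ w : List S, wordValue w = g ∧ wordWeight ω w = n} (elementWeight ω g) :=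
  let ⟨w, hw⟩ := exists_wordValue_eq hgen g
  ⟨Nat.sInf_mem ⟨_, w, hw, rfl⟩, fun _ => Nat.sInf_le⟩

theorem isLeast_cosetWeight (hgen : Submonoid.closure S = ⊤) (ω : S → ℕ+) (H : Subgroup G)
    (c : RightCosets H) :
    IsLeast {n | ∃ w : List S, Quotient.mk (QuotientGroup.rightRel H) (wordValue w) = c ∧
      wordWeight ω w = n} (cosetWeight ω H c) := by
  constructor
  · obtain ⟨g, hg⟩ := Quotient.exists_rep c
    obtain ⟨g', hg', hn⟩ := Nat.sInf_mem (s := {n | ∃ g : G,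
      Quotient.mk (QuotientGroup.rightRel H) g = c ∧ elementWeight ω g = n}) ⟨_, g, hg, rfl⟩
    obtain ⟨w, rfl, hw⟩ := (isLeast_elementWeight hgen ω g').1
    exact ⟨w, hg', hw.trans hn⟩
  · rintro _ ⟨w, hw, rfl⟩
    have h : cosetWeight ω H c ≤ elementWeight ω (wordValue w) :=
      Nat.sInf_le ⟨wordValue w, hw, rfl⟩
    exact h.trans ((isLeast_elementWeight hgen ω _).2 ⟨w, rfl, rfl⟩)

theorem isLeast_cosetWeight_symm (hgen : Submonoid.closure S = ⊤) (ω : S → ℕ+) (H : Subgroup G)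
    (x : G ⧸ H) :
    IsLeast {n | ∃ w : List S, wordValue w • x = ((1 : G) : G ⧸ H) ∧ wordWeight ω w = n}
      (cosetWeight ω H ((QuotientGroup.quotientRightRelEquivQuotientLeftRel H).symm x)) := by
  convert isLeast_cosetWeight hgen ω H _ using 4 with n w
  obtain ⟨k, rfl⟩ := QuotientGroup.mk_surjective x
  ext w
  refine and_congr_left fun _ => ?_
  have hk : (QuotientGroup.quotientRightRelEquivQuotientLeftRel H).symm k =
      Quotient.mk (QuotientGroup.rightRel H) k⁻¹ := rfl
  rw [hk, eq_comm, MulAction.Quotient.smul_coe, QuotientGroup.eq, Quotient.eq,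
    QuotientGroup.rightRel_apply, ← mul_inv_rev, inv_mem_iff]
  simp

end Cosets

end CosetGrowth

theorem theoremB {G : Type*} [Group G] (hG : CosetGrowth.IsVirtuallyAbelian G)
    (S : Set G) (hfin : S.Finite) (hgen : Submonoid.closure S = ⊤) (ω : S → ℕ+)
    (H : Subgroup G) :
    (∀ n : ℕ, (CosetGrowth.cosetSphere ω H n).Finite) ∧
      CosetGrowth.IsRationalSeries (CosetGrowth.cosetGrowthSeries ω H) := by
  obtain ⟨A, _, _⟩ := hG
  have : Finite S := hfin
  let e := QuotientGroup.quotientRightRelEquivQuotientLeftRel H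
  have hgrowth : CosetGrowth.HasRationalGrowth (CosetGrowth.cosetWeight ω H ∘ e.symm) Set.univ :=
    CosetGrowth.hasRationalGrowth_of_isLeast_words A
      (CosetGrowth.isLeast_cosetWeight_symm hgen ω H)
  have himage := hgrowth.image (wt := CosetGrowth.cosetWeight ω H) e.symm.injective.injOn (d := 0)
    fun x _ => (zero_add _).symm
  rw [Set.image_univ, e.symm.range_eq_univ] at himage
  simp only [CosetGrowth.HasRationalGrowth, CosetGrowth.countingSeries, Set.univ_inter] at himage
  exact himage
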